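/- All graphs are finite and simple; the order of a graph $G$ is its number of vertices and $e(G)$ is its number of edges. For a set $S$ of at least two vertices of $G$, let $\kappa(S)$ be the maximum number $\ell$ of pairwise edge-disjoint trees $T_1,\dots,T_\ell$ in $G$ such that $S\subseteq V(T_i)$ for every $i$ and $V(T_i)\cap V(T_j)=S$ for all $i\neq j$. For a graph $G$ of order at least $3$, the generalized $3$-connectivity $\kappa_3(G)$ is the minimum of $\kappa(S)$ over all $3$-element sets $S\subseteq V(G)$ (so $\kappa_3(G)=0$ if $G$ is disconnected). **Theorem 1.** (a) If $G$ is a graph of order $n$ with $\kappa_3(G)=2$, then $e(G)\ge\lceil \tfrac65 n\rceil$. (b) For every $n\ge 4$ with $n\ne 9,10$ there is a connected graph $G$ of order $n$ with $\kappa_3(G)=2$ and $e(G)=\lceil \tfrac65 n\rceil$. (c) For $n\in\{9,10\}$, every graph $G$ of order $n$ with $\kappa_3(G)=2$ satisfies $e(G)\ge\lceil \tfrac65 n\rceil+1$, and there is a connected graph $G$ of order $n$ with $\kappa_3(G)=2$ and $e(G)=\lceil \tfrac65 n\rceil+1$. -/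

import Mathlib

namespace GenConn

/-- `T 0, …, T (ℓ - 1)` are trees in `G` connecting `S`: each contains `S`, they are pairwise
edge-disjoint, and any two distinct ones have exactly the vertices of `S` in common. -/
structure IsTreeFamily {V : Type*} (G : SimpleGraph V) (S : Finset V) {ℓ : ℕ}
    (T : Fin ℓ → G.Subgraph) : Prop where
  isTree : ∀ i, (T i).coe.IsTree
  subset_verts : ∀ i, (S : Set V) ⊆ (T i).verts
  edge_disjoint : ∀ i j, i ≠ j → Disjoint (T i).edgeSet (T j).edgeSet
  verts_inter : ∀ i j, i ≠ j → (T i).verts ∩ (T j).verts = (S : Set V)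

/-- `κ(S)`: the maximum number of pairwise edge-disjoint trees of `G` that contain `S` and
pairwise meet exactly in `S`. In a finite graph with `2 ≤ |S|` the supremum is an attained,
finite maximum. -/
noncomputable def kappaSet {V : Type*} (G : SimpleGraph V) (S : Finset V) : ℕ∞ :=
  ⨆ ℓ ∈ {ℓ : ℕ | ∃ T : Fin ℓ → G.Subgraph, IsTreeFamily G S T}, (ℓ : ℕ∞)

/-- The generalized `k`-connectivity `κ_k(G)`: the minimum of `κ(S)` over all `k`-subsets `S` of
the vertex set (it is `⊤` if there is no `k`-subset). -/
noncomputable def genConnectivity {V : Type*} (k : ℕ) (G : SimpleGraph V) : ℕ∞ :=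
  ⨅ S ∈ {S : Finset V | S.card = k}, kappaSet G S

end GenConn

/-!
If two edge-disjoint trees join a set of at least three vertices and meet only there, each
terminal has an edge in both of them. Hence all degrees are at least two, and a terminal of degree
two has just one edge in each tree. So no two vertices of degree two are adjacent: if both are
terminals, the edge between them would be a component of its tree, which cuts off the third
terminal. Counting the edges at the vertices of degree two and the sum of all degrees yields
`6 * n ≤ 5 * e`. If `n` is `9` or `10` and `e = n + 2`, the same count leaves exactly four vertices
of degree three, the hubs, and at least five vertices of degree two, each of which subdivides an
edge between two hubs. However, three terminals cannot be chosen on the edges of a triangle, and if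
they are chosen on a path through the four hubs, two further edges between hubs are needed, while
there is room for at most one. This leaves at most four vertices of degree two.

The extremal graphs have `n + k` edges with `k = ⌈n / 5⌉`, except that `k = 3` if `n` is `9` or
`10`. They arise from the Möbius ladder with `k` rungs by subdividing each edge once, which yields
`5 * k` vertices and `6 * k` edges, and then suppressing `5 * k - n` of the new vertices again. If
`k > 3`, a triple of vertices misses one of the rungs together with the rails that lead to the
next one; these can be contracted without affecting the triple, which reduces the proof to
`k = 3`. There, as in the few smaller graphs, the two subgraphs that join a triple are the two
classes of a suitable 2-colouring of the vertices, found by search.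
-/

namespace GenConn

open SimpleGraph

section JoiningPair

variable {V : Type*} {G K L : SimpleGraph V} {S : Set V}

/-- Two edge-disjoint subgraphs `K` and `L` of `G` that share vertices only in `S` and each of
which connects the vertices of `S`. This is a pair of trees as in `IsTreeFamily`, except that no
minimality is imposed, which makes such pairs easier to construct and to transport. -/
structure IsJoiningPair (G : SimpleGraph V) (S : Set V) (K L : SimpleGraph V) : Prop where
  left_le : K ≤ G
  right_le : L ≤ G
  not_adj : ∀ ⦃x y⦄, K.Adj x y → ¬ L.Adj x y
  mem_of_adj : ∀ ⦃x y z⦄, K.Adj x y → L.Adj x z → x ∈ S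
  left_reachable : ∀ ⦃x⦄, x ∈ S → ∀ ⦃y⦄, y ∈ S → K.Reachable x y
  right_reachable : ∀ ⦃x⦄, x ∈ S → ∀ ⦃y⦄, y ∈ S → L.Reachable x y

/-- The relation `κ(S) ≥ 2`, expressed through joining pairs; see `two_le_kappaSet_iff`. -/
def DoublyJoined (G : SimpleGraph V) (S : Set V) : Prop :=
  ∃ K L, IsJoiningPair G S K L

namespace IsJoiningPair

protected lemma symm (h : IsJoiningPair G S K L) : IsJoiningPair G S L K where
  left_le := h.right_le
  right_le := h.left_le
  not_adj _ _ hL hK := h.not_adj hK hL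
  mem_of_adj _ _ _ hL hK := h.mem_of_adj hK hL
  left_reachable := h.right_reachable
  right_reachable := h.left_reachable

lemma exists_adj (h : IsJoiningPair G S K L) (hS : S.Nontrivial) {x : V} (hx : x ∈ S) :
    ∃ y, K.Adj x y :=
  have ⟨_, hy, hne⟩ := hS.exists_ne x
  (h.left_reachable hx hy).nonempty_neighborSet_left hne.symm

lemma not_adj_of_adj_of_notMem (h : IsJoiningPair G S K L) {x y z : V} (hz : z ∉ S)
    (hx : K.Adj x z) : ¬ L.Adj y z :=
  fun hy => hz (h.mem_of_adj hx.symm hy.symm)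

end IsJoiningPair

lemma mem_of_reachable {X : Set V} (hX : ∀ x ∈ X, ∀ y, K.Adj x y → y ∈ X) {x y : V}
    (hxy : K.Reachable x y) (hx : x ∈ X) : y ∈ X := by
  obtain ⟨p⟩ := hxy
  induction p with
  | nil => exact hx
  | cons hadj _ ih => exact ih (hX _ hx _ hadj)

lemma reachable_of_forall_adj_reachable {W : Type*} {H : SimpleGraph W} (f : V → W)
    (h : ∀ x y, K.Adj x y → H.Reachable (f x) (f y)) {x y : V} (hxy : K.Reachable x y) :
    H.Reachable (f x) (f y) := by
  obtain ⟨p⟩ := hxy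
  induction p with
  | nil => exact .rfl
  | cons hadj _ ih => exact (h _ _ hadj).trans ih

end JoiningPair

section Kappa

variable {V : Type*} {G K : SimpleGraph V} {S : Finset V}

lemma exists_subgraph_isTree (hK : K ≤ G) (s : V) :
    ∃ T : G.Subgraph, T.coe.IsTree ∧ T.verts = {x | K.Reachable s x} ∧ T.spanningCoe ≤ K := by
  obtain ⟨F, hFK, hF, hFr⟩ := K.exists_isAcyclic_reachable_eq_le
  set C := F.connectedComponentMk s
  refine ⟨(toSubgraph F (hFK.trans hK)).induce C.supp, ?_, ?_, ?_⟩
  · have hcoe : ((toSubgraph F (hFK.trans hK)).induce C.supp).coe = C.toSimpleGraph := by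
      ext x y
      exact ⟨fun h => h.2.2, fun h => ⟨x.2, y.2, h⟩⟩
    exact hcoe ▸ hF.isTree_connectedComponent C
  · ext x
    simp [C, ← hFr, reachable_comm (v := s)]
  · exact fun x y h => hFK h.2.2

lemma IsTreeFamily.exists_adj {ℓ : ℕ} {T : Fin ℓ → G.Subgraph} (hT : IsTreeFamily G S T)
    (hS : 2 ≤ S.card) {v : V} (hv : v ∈ S) (i : Fin ℓ) : ∃ y, (T i).Adj v y := by
  obtain ⟨w, hw, hne⟩ := S.exists_mem_ne hS v
  obtain ⟨y, hy⟩ := ((hT.isTree i).connected.preconnected ⟨v, hT.subset_verts i hv⟩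
    ⟨w, hT.subset_verts i hw⟩).nonempty_neighborSet_left (by simpa using hne.symm)
  exact ⟨y, hy⟩

lemma IsTreeFamily.isJoiningPair {ℓ : ℕ} {T : Fin ℓ → G.Subgraph} (hT : IsTreeFamily G S T)
    {i j : Fin ℓ} (hij : i ≠ j) :
    IsJoiningPair G S (T i).spanningCoe (T j).spanningCoe := by
  have hreach (i : Fin ℓ) ⦃x : V⦄ (hx : x ∈ S) ⦃y : V⦄ (hy : y ∈ S) :
      (T i).spanningCoe.Reachable x y :=
    ((hT.isTree i).connected.preconnected ⟨x, hT.subset_verts i hx⟩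
      ⟨y, hT.subset_verts i hy⟩).map ⟨Subtype.val, id⟩
  refine ⟨(T i).spanningCoe_le, (T j).spanningCoe_le, fun x y hi hj => ?_, fun x y z hi hj => ?_,
    hreach i, hreach j⟩
  · exact Set.disjoint_left.1 (hT.edge_disjoint i j hij) (show s(x, y) ∈ _ from hi) hj
  · rw [← hT.verts_inter i j hij]
    exact ⟨(T i).edge_vert hi, (T j).edge_vert hj⟩

lemma IsJoiningPair.two_le_kappaSet {L : SimpleGraph V} (h : IsJoiningPair G S K L)
    (hS : S.Nonempty) : 2 ≤ kappaSet G S := by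
  obtain ⟨s, hs⟩ := hS
  obtain ⟨T, hT, hTv, hTK⟩ := exists_subgraph_isTree h.left_le s
  obtain ⟨U, hU, hUv, hUL⟩ := exists_subgraph_isTree h.right_le s
  have hST : (S : Set V) ⊆ T.verts := hTv ▸ fun x hx => h.left_reachable hs hx
  have hSU : (S : Set V) ⊆ U.verts := hUv ▸ fun x hx => h.right_reachable hs hx
  have hdisj : Disjoint T.edgeSet U.edgeSet := Set.disjoint_left.2 fun e => by
    induction e with
    | _ x y => exact fun hT hU => h.not_adj (hTK hT) (hUL hU)
  have hinter : T.verts ∩ U.verts = S := by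
    refine Set.Subset.antisymm (fun x hx => ?_) (Set.subset_inter hST hSU)
    rw [hTv, hUv] at hx
    obtain rfl | hne := eq_or_ne x s
    · exact hs
    · obtain ⟨y, hy⟩ := hx.1.symm.nonempty_neighborSet_left hne
      obtain ⟨z, hz⟩ := hx.2.symm.nonempty_neighborSet_left hne
      exact h.mem_of_adj hy hz
  refine le_iSup₂_of_le (f := fun (ℓ : ℕ) (_ : ℓ ∈ _) => (ℓ : ℕ∞)) 2
    ⟨![T, U], ?_, ?_, ?_, ?_⟩ le_rfl
  · simp [Fin.forall_fin_two, hT, hU]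
  · simp [Fin.forall_fin_two, hST, hSU]
  · simp [Fin.forall_fin_two, hdisj, hdisj.symm]
  · simp [Fin.forall_fin_two, hinter, Set.inter_comm U.verts]

lemma two_le_kappaSet_iff (hS : S.Nonempty) : 2 ≤ kappaSet G S ↔ DoublyJoined G S := by
  refine ⟨fun h => ?_, fun ⟨_, _, h⟩ => h.two_le_kappaSet hS⟩
  obtain ⟨ℓ, ⟨T, hT⟩, hℓ⟩ : ∃ ℓ ∈ {ℓ : ℕ | ∃ T : Fin ℓ → G.Subgraph, IsTreeFamily G S T},
      (1 : ℕ∞) < ℓ := by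
    simpa only [kappaSet, lt_iSup_iff, exists_prop] using
      (by decide : (1 : ℕ∞) < 2).trans_le h
  have hℓ : 1 < ℓ := by exact_mod_cast hℓ
  exact ⟨_, _, hT.isJoiningPair (i := ⟨0, by omega⟩) (j := ⟨1, hℓ⟩) (by simp)⟩

lemma two_le_genConnectivity_iff {k : ℕ} (hk : k ≠ 0) :
    2 ≤ genConnectivity k G ↔ ∀ S : Finset V, S.card = k → DoublyJoined G S := by
  simp only [genConnectivity, le_iInf_iff, Set.mem_ofPred_eq]
  exact forall₂_congr fun S hS => two_le_kappaSet_iff (Finset.card_pos.1 (by omega))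

lemma doublyJoined_triple (h : 2 ≤ genConnectivity 3 G) {x y z : V} (hxy : x ≠ y)
    (hxz : x ≠ z) (hyz : y ≠ z) : DoublyJoined G {x, y, z} := by
  classical
  simpa using (two_le_genConnectivity_iff (by norm_num)).1 h {x, y, z}
    (Finset.card_eq_three.2 ⟨x, y, z, hxy, hxz, hyz, rfl⟩)

lemma kappaSet_le_degree (hS : 2 ≤ S.card) {v : V} (hv : v ∈ S) [Fintype (G.neighborSet v)] :
    kappaSet G S ≤ G.degree v := by
  refine iSup₂_le fun ℓ ⟨T, hT⟩ => ?_
  choose f hf using hT.exists_adj hS hv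
  have hinj : f.Injective := fun i j hij => by
    by_contra hne
    exact Set.disjoint_left.1 (hT.edge_disjoint i j hne) (show s(v, f i) ∈ _ from hf i) (hij ▸ hf j)
  have hle := Finset.card_le_card_of_injOn (s := .univ) (t := G.neighborFinset v) f
    (fun i _ => by simpa using (hf i).adj_sub) hinj.injOn
  simpa using hle

variable [Fintype V] {k : ℕ}

lemma genConnectivity_le_degree (hk : 2 ≤ k) (hkV : k ≤ Fintype.card V) (v : V)
    [Fintype (G.neighborSet v)] : genConnectivity k G ≤ G.degree v := by
  obtain ⟨S, hvS, -, hS⟩ := Finset.exists_subsuperset_card_eq (s := {v}) (t := .univ) (n := k)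
    (by simp) (by simp; omega) (by simpa)
  exact (iInf₂_le S hS).trans (kappaSet_le_degree (hk.trans_eq hS.symm) (hvS (by simp)))

lemma exists_finset_card_eq_mem_mem (hk : 2 ≤ k) (hkV : k ≤ Fintype.card V)
    (x y : V) : ∃ S : Finset V, x ∈ S ∧ y ∈ S ∧ S.card = k := by
  classical
  obtain ⟨S, hS, -, hSk⟩ := Finset.exists_subsuperset_card_eq (s := {x, y}) (t := .univ) (n := k)
    (by simp) (Finset.card_le_two.trans hk) (by simpa)
  exact ⟨S, hS (by simp), hS (by simp), hSk⟩

lemma connected_of_two_le_genConnectivity (hk : 2 ≤ k) (hkV : k ≤ Fintype.card V)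
    (h : 2 ≤ genConnectivity k G) : G.Connected := by
  have : Nonempty V := Fintype.card_pos_iff.1 (by omega)
  refine Connected.mk fun x y => ?_
  obtain ⟨S, hx, hy, hS⟩ := exists_finset_card_eq_mem_mem hk hkV x y
  obtain ⟨K, L, hKL⟩ := (two_le_genConnectivity_iff (by omega)).1 h S hS
  exact (hKL.left_reachable hx hy).mono hKL.left_le

end Kappa

section DegreeTwo

variable {V : Type*} [Fintype V] {G K L : SimpleGraph V} [DecidableRel G.Adj] {S : Set V}
  {x y z p q r : V}

lemma eq_or_eq_of_adj_of_degree_eq_two (hx : G.degree x = 2) (hp : G.Adj x p) (hq : G.Adj x q)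
    (hpq : p ≠ q) (hr : G.Adj x r) : r = p ∨ r = q := by
  classical
  have hsub : {p, q} ⊆ G.neighborFinset x := by simp [Finset.insert_subset_iff, hp, hq]
  have heq := Finset.eq_of_subset_of_card_le hsub (by simp [hx, Finset.card_pair hpq])
  have hr : r ∈ G.neighborFinset x := by simpa
  simpa [← heq] using hr

namespace IsJoiningPair

lemma adj_or_adj_of_degree_eq_two (h : IsJoiningPair G S K L) (hS : S.Nontrivial) (hxS : x ∈ S)
    (hx : G.degree x = 2) (hp : G.Adj x p) : K.Adj x p ∨ L.Adj x p := by
  obtain ⟨a, ha⟩ := h.exists_adj hS hxS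
  obtain ⟨b, hb⟩ := h.symm.exists_adj hS hxS
  have hab : a ≠ b := fun hab => h.not_adj ha (hab ▸ hb)
  obtain rfl | rfl :=
    eq_or_eq_of_adj_of_degree_eq_two hx (h.left_le ha) (h.right_le hb) hab hp
  exacts [.inl ha, .inr hb]

lemma eq_of_adj_of_degree_eq_two (h : IsJoiningPair G S K L) (hS : S.Nontrivial) (hxS : x ∈ S)
    (hx : G.degree x = 2) (hp : K.Adj x p) (hq : K.Adj x q) : p = q := by
  obtain ⟨b, hb⟩ := h.symm.exists_adj hS hxS
  have hpb : p ≠ b := fun hpb => h.not_adj hp (hpb ▸ hb)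
  refine ((eq_or_eq_of_adj_of_degree_eq_two hx (h.left_le hp) (h.right_le hb) hpb
    (h.left_le hq)).resolve_right fun hqb => ?_).symm
  exact h.not_adj hq (hqb ▸ hb)

-- The edge `xy` would be a whole component of `K`, cutting `z` off.
lemma not_adj_of_degree_eq_two (h : IsJoiningPair G S K L) (hxS : x ∈ S) (hyS : y ∈ S)
    (hzS : z ∈ S) (hzx : z ≠ x) (hzy : z ≠ y) (hx : G.degree x = 2) (hy : G.degree y = 2) :
    ¬ K.Adj x y := fun hxy => by
  have hS : S.Nontrivial := ⟨x, hxS, z, hzS, hzx.symm⟩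
  have hclosed : ∀ a ∈ ({x, y} : Set V), ∀ b, K.Adj a b → b ∈ ({x, y} : Set V) := by
    rintro a (rfl | rfl) b hab
    · exact .inr (h.eq_of_adj_of_degree_eq_two hS hxS hx hab hxy)
    · exact .inl (h.eq_of_adj_of_degree_eq_two hS hyS hy hab hxy.symm)
  obtain rfl | rfl := mem_of_reachable hclosed (h.left_reachable hxS hzS) (by simp)
  exacts [hzx rfl, hzy rfl]

end IsJoiningPair

lemma DoublyJoined.not_adj_of_degree_eq_two (h : DoublyJoined G S) (hxS : x ∈ S) (hyS : y ∈ S)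
    (hzS : z ∈ S) (hzx : z ≠ x) (hzy : z ≠ y) (hx : G.degree x = 2) (hy : G.degree y = 2) :
    ¬ G.Adj x y := fun hxy => by
  obtain ⟨K, L, h⟩ := h
  obtain hxy | hxy := h.adj_or_adj_of_degree_eq_two ⟨x, hxS, z, hzS, hzx.symm⟩ hxS hx hxy
  · exact h.not_adj_of_degree_eq_two hxS hyS hzS hzx hzy hx hy hxy
  · exact h.symm.not_adj_of_degree_eq_two hxS hyS hzS hzx hzy hx hy hxy

lemma two_mul_card_add_card_le_card_edgeFinset {D : Finset V}
    (hD : ∀ x ∈ D, G.degree x = 2) (hind : G.IsIndepSet D) {F : Finset (Sym2 V)}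
    (hF : F ⊆ G.edgeFinset) (hFD : ∀ e ∈ F, ∀ x ∈ e, x ∉ D) :
    2 * D.card + F.card ≤ G.edgeFinset.card := by
  classical
  have hdisj : (D : Set V).PairwiseDisjoint fun x => G.incidenceFinset x := by
    refine fun x hx y hy hxy => Finset.disjoint_left.2 fun e hex hey => ?_
    rw [mem_incidenceFinset] at hex hey
    exact hind hx hy hxy (G.adj_of_mem_incidenceSet hxy hex hey)
  have hdisjF : Disjoint (D.biUnion fun x => G.incidenceFinset x) F := by
    refine Finset.disjoint_left.2 fun e he heF => ?_
    obtain ⟨x, hx, he⟩ := Finset.mem_biUnion.1 he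
    exact hFD e heF x ((mem_incidenceFinset ..).1 he).2 hx
  have hcard : (D.biUnion fun x => G.incidenceFinset x).card = 2 * D.card := by
    rw [Finset.card_biUnion hdisj,
      Finset.sum_congr rfl fun x hx => (G.card_incidenceFinset_eq_degree x).trans (hD x hx)]
    simp [mul_comm]
  rw [← hcard, ← Finset.card_union_of_disjoint hdisjF]
  exact Finset.card_le_card
    (Finset.union_subset (Finset.biUnion_subset.2 fun x _ => G.incidenceFinset_subset x) hF)

lemma three_mul_card_le_two_mul_card_edgeFinset_add (hdeg : ∀ v, 2 ≤ G.degree v) :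
    3 * Fintype.card V ≤ 2 * G.edgeFinset.card + ({x | G.degree x = 2} : Finset V).card := by
  rw [← G.sum_degrees_eq_twice_card_edges, Finset.card_filter, ← Finset.sum_add_distrib]
  have : ∑ _v : V, 3 ≤ ∑ v, (G.degree v + if G.degree v = 2 then 1 else 0) :=
    Finset.sum_le_sum fun v _ => by have := hdeg v; split_ifs <;> omega
  simpa [mul_comm] using this

end DegreeTwo

section LowerBound

variable {V : Type*} [Fintype V] {G : SimpleGraph V} {k : ℕ}

lemma le_card_of_genConnectivity_ne_top (h : genConnectivity k G ≠ ⊤) :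
    k ≤ Fintype.card V := by
  contrapose! h
  simp only [genConnectivity, iInf_eq_top, Set.mem_ofPred_eq]
  intro S hS
  have := S.card_le_univ
  omega

variable [DecidableRel G.Adj]

lemma two_le_degree (hk : 2 ≤ k) (hkV : k ≤ Fintype.card V)
    (h : 2 ≤ genConnectivity k G) (v : V) : 2 ≤ G.degree v := by
  exact_mod_cast h.trans (genConnectivity_le_degree hk hkV v)

lemma isIndepSet_degree_eq_two (hk : 3 ≤ k) (hkV : k ≤ Fintype.card V)
    (h : 2 ≤ genConnectivity k G) :
    G.IsIndepSet {x | G.degree x = 2} := fun x hx y hy _ => by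
  obtain ⟨S, hxS, hyS, hS⟩ := exists_finset_card_eq_mem_mem (by omega) hkV x y
  classical
  obtain ⟨z, hzS, hz⟩ := Finset.exists_mem_notMem_of_card_lt_card
    (Finset.card_le_two.trans_lt (by omega) : ({x, y} : Finset V).card < S.card)
  simp only [Finset.mem_insert, Finset.mem_singleton, not_or] at hz
  exact ((two_le_genConnectivity_iff (by omega)).1 h S hS).not_adj_of_degree_eq_two
    hxS hyS hzS hz.1 hz.2 hx hy

lemma six_mul_card_le_five_mul_card_edgeFinset (hk : 3 ≤ k) (hkV : k ≤ Fintype.card V)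
    (h : 2 ≤ genConnectivity k G) :
    6 * Fintype.card V ≤ 5 * G.edgeFinset.card := by
  classical
  have hsum := three_mul_card_le_two_mul_card_edgeFinset_add (two_le_degree (by omega) hkV h)
  have hdeg := two_mul_card_add_card_le_card_edgeFinset (G := G)
    (D := {x | G.degree x = 2}) (F := ∅) (by simp)
    (by simpa using isIndepSet_degree_eq_two hk hkV h) (by simp) (by simp)
  rw [Finset.card_empty] at hdeg
  omega

end LowerBound

section Subdividers

variable {V : Type*} [Fintype V] {G K L : SimpleGraph V} [DecidableRel G.Adj] {S : Set V}
  {p q r p' q' x y z : V}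

variable (G) in
/-- The vertices of degree two with neighbours `p` and `q`: those that subdivide an edge `pq` of
the multigraph obtained by suppressing the vertices of degree two. -/
def subdividers (p q : V) : Finset V :=
  {w | G.degree w = 2 ∧ G.Adj w p ∧ G.Adj w q}

lemma mem_subdividers : x ∈ subdividers G p q ↔ G.degree x = 2 ∧ G.Adj x p ∧ G.Adj x q := by
  simp [subdividers]

variable (G) in
lemma subdividers_comm (p q : V) : subdividers G p q = subdividers G q p := by
  ext
  simp only [mem_subdividers]
  tauto

lemma sym2_eq_of_mem_subdividers (hpq : p ≠ q) (hpq' : p' ≠ q') (hx : x ∈ subdividers G p q)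
    (hx' : x ∈ subdividers G p' q') : s(p, q) = s(p', q') := by
  rw [mem_subdividers] at hx hx'
  have hp' := eq_or_eq_of_adj_of_degree_eq_two hx.1 hx.2.1 hx.2.2 hpq hx'.2.1
  have hq' := eq_or_eq_of_adj_of_degree_eq_two hx.1 hx.2.1 hx.2.2 hpq hx'.2.2
  grind

lemma ne_of_mem_subdividers (hpq : p ≠ q) (hpq' : p' ≠ q') (hne : s(p, q) ≠ s(p', q'))
    (hx : x ∈ subdividers G p q) (hy : y ∈ subdividers G p' q') : x ≠ y := by
  rintro rfl
  exact hne (sym2_eq_of_mem_subdividers hpq hpq' hx hy)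

lemma IsJoiningPair.adj_of_mem_subdividers (h : IsJoiningPair G S K L) (hS : S.Nontrivial)
    (hxS : x ∈ S) (hpq : p ≠ q) (hx : x ∈ subdividers G p q) :
    (K.Adj x p ∧ L.Adj x q) ∨ (L.Adj x p ∧ K.Adj x q) := by
  obtain ⟨hdeg, hp, hq⟩ := mem_subdividers.1 hx
  have hK := h.eq_of_adj_of_degree_eq_two hS hxS hdeg (p := p) (q := q)
  have hL := h.symm.eq_of_adj_of_degree_eq_two hS hxS hdeg (p := p) (q := q)
  have hp := h.adj_or_adj_of_degree_eq_two hS hxS hdeg hp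
  have hq := h.adj_or_adj_of_degree_eq_two hS hxS hdeg hq
  tauto

-- If `K` and `L` join `x`, `y` and `z`, each of these vertices sends `K` to one end of its edge and
-- `L` to the other. No hub is reached by both, so this would be a proper 2-colouring of a triangle.
lemma notMem_subdividers_of_triangle (h : 2 ≤ genConnectivity 3 G) (hpq : p ≠ q) (hqr : q ≠ r)
    (hrp : r ≠ p) (hp : G.degree p ≠ 2) (hq : G.degree q ≠ 2) (hr : G.degree r ≠ 2)
    (hx : x ∈ subdividers G p q) (hy : y ∈ subdividers G q r) : z ∉ subdividers G r p :=
  fun hz => by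
  have hxy : x ≠ y := ne_of_mem_subdividers hpq hqr (by grind) hx hy
  have hxz : x ≠ z := ne_of_mem_subdividers hpq hrp (by grind) hx hz
  have hyz : y ≠ z := ne_of_mem_subdividers hqr hrp (by grind) hy hz
  obtain ⟨K, L, h⟩ := doublyJoined_triple h hxy hxz hyz
  have hhub {v : V} (hv : G.degree v ≠ 2) : v ∉ ({x, y, z} : Set V) := by
    rintro (rfl | rfl | rfl)
    exacts [hv (mem_subdividers.1 hx).1, hv (mem_subdividers.1 hy).1, hv (mem_subdividers.1 hz).1]
  have hS : ({x, y, z} : Set V).Nontrivial := ⟨x, by simp, y, by simp, hxy⟩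
  have hxadj := h.adj_of_mem_subdividers hS (by simp) hpq hx
  have hyadj := h.adj_of_mem_subdividers hS (by simp) hqr hy
  have hzadj := h.adj_of_mem_subdividers hS (by simp) hrp hz
  have hp' {u v : V} := h.not_adj_of_adj_of_notMem (x := u) (y := v) (hhub hp)
  have hq' {u v : V} := h.not_adj_of_adj_of_notMem (x := u) (y := v) (hhub hq)
  have hr' {u v : V} := h.not_adj_of_adj_of_notMem (x := u) (y := v) (hhub hr)
  grind

lemma adj_or_nonempty_subdividers_of_reachable (hK : K ≤ G)
    (hind : G.IsIndepSet {x | G.degree x = 2}) (hpq : p ≠ q) (hq : G.degree q ≠ 2)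
    (hhub : ∀ u v, G.degree v ≠ 2 → K.Adj u v → v = p ∨ v = q) (hr : K.Reachable p q) :
    G.Adj p q ∨ (subdividers G p q).Nonempty := by
  by_contra! hcon
  obtain ⟨hnadj, hempty⟩ := hcon
  have hclosed : ∀ u ∈ {v | v = p ∨ G.degree v = 2 ∧ G.Adj v p}, ∀ v, K.Adj u v →
      v ∈ {v | v = p ∨ G.degree v = 2 ∧ G.Adj v p} := by
    intro u hu v huv
    by_cases hv : G.degree v = 2
    · obtain rfl | ⟨hu, -⟩ := hu
      · exact .inr ⟨hv, (hK huv).symm⟩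
      · exact absurd (hK huv) (hind hu hv huv.ne)
    · obtain rfl | rfl := hhub u v hv huv
      · exact .inl rfl
      · obtain rfl | ⟨hu, hup⟩ := hu
        · exact absurd (hK huv) hnadj
        · exact absurd (mem_subdividers.2 ⟨hu, hup, hK huv⟩) (hempty ▸ Finset.notMem_empty u)
  obtain rfl | ⟨hq', -⟩ := mem_of_reachable hclosed hr (.inl rfl)
  exacts [hpq rfl, hq hq']

-- Otherwise `p`, `q` and their common neighbours form a component that misses `r`.
lemma card_subdividers_lt_three (h : 2 ≤ genConnectivity 3 G) (hpq : p ≠ q)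
    (hr : G.degree r ≠ 2) (hrp : r ≠ p) (hrq : r ≠ q) (hp : G.degree p ≤ 3)
    (hq : G.degree q ≤ 3) : (subdividers G p q).card < 3 := by
  by_contra! hge
  obtain ⟨K, L, h⟩ := doublyJoined_triple h hpq hrp.symm hrq.symm
  have hNp : subdividers G p q = G.neighborFinset p := Finset.eq_of_subset_of_card_le
    (fun w hw => by simpa using (mem_subdividers.1 hw).2.1.symm) (by simpa using hp.trans hge)
  have hNq : subdividers G p q = G.neighborFinset q := Finset.eq_of_subset_of_card_le
    (fun w hw => by simpa using (mem_subdividers.1 hw).2.2.symm) (by simpa using hq.trans hge)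
  have hclosed : ∀ u ∈ {v | v = p ∨ v = q ∨ v ∈ subdividers G p q}, ∀ v, K.Adj u v →
      v ∈ {v | v = p ∨ v = q ∨ v ∈ subdividers G p q} := by
    rintro u (rfl | rfl | hu) v huv
    · exact .inr (.inr (by simpa [hNp] using h.left_le huv))
    · exact .inr (.inr (by simpa [hNq] using h.left_le huv))
    · obtain ⟨hu, hup, huq⟩ := mem_subdividers.1 hu
      exact (eq_or_eq_of_adj_of_degree_eq_two hu hup huq hpq (h.left_le huv)).imp_right .inl
  obtain rfl | rfl | hr' :=
    mem_of_reachable hclosed (h.left_reachable (by simp) (by simp)) (y := r) (.inl rfl)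
  exacts [hrp rfl, hrq rfl, hr (mem_subdividers.1 hr').1]

lemma exists_mem_subdividers (hind : G.IsIndepSet {x | G.degree x = 2}) (hx : G.degree x = 2) :
    ∃ p q, p ≠ q ∧ G.degree p ≠ 2 ∧ G.degree q ≠ 2 ∧ x ∈ subdividers G p q := by
  classical
  obtain ⟨p, q, hpq, hN⟩ := Finset.card_eq_two.1 ((G.card_neighborFinset_eq_degree x).trans hx)
  have hp : G.Adj x p := by simp [← mem_neighborFinset, hN]
  have hq : G.Adj x q := by simp [← mem_neighborFinset, hN]
  exact ⟨p, q, hpq, fun h => hind hx h hp.ne hp, fun h => hind hx h hq.ne hq,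
    mem_subdividers.2 ⟨hx, hp, hq⟩⟩

end Subdividers

section FourHubs

variable {V : Type*} [Fintype V] {G K L : SimpleGraph V} [DecidableRel G.Adj] {S : Set V}
  {a b c d x y z : V}

lemma IsJoiningPair.adj_of_subdivided_path (hKL : IsJoiningPair G S K L)
    (h : 2 ≤ genConnectivity 3 G) (hind : G.IsIndepSet {x | G.degree x = 2})
    (hhub : ∀ v, G.degree v ≠ 2 ↔ v ∈ ({a, b, c, d} : Set V)) (hS : ∀ v ∈ S, G.degree v = 2)
    (hab : a ≠ b) (hac : a ≠ c) (hbc : b ≠ c) (hxS : x ∈ S) (hyS : y ∈ S)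
    (hx : x ∈ subdividers G a b) (hy : y ∈ subdividers G b c)
    (hxa : K.Adj x a) (hxb : L.Adj x b) (hyc : K.Adj y c) (hzd : L.Adj z d) : G.Adj a c := by
  have ha : G.degree a ≠ 2 := (hhub a).2 (by simp)
  have hb : G.degree b ≠ 2 := (hhub b).2 (by simp)
  have hc : G.degree c ≠ 2 := (hhub c).2 (by simp)
  have hK : ∀ u v, G.degree v ≠ 2 → K.Adj u v → v = a ∨ v = c := by
    intro u v hv huv
    have hvS : v ∉ S := fun hvS => hv (hS v hvS)
    obtain rfl | rfl | rfl | rfl := (hhub v).1 hv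
    · exact .inl rfl
    · exact absurd hxb (hKL.not_adj_of_adj_of_notMem hvS huv)
    · exact .inr rfl
    · exact absurd hzd (hKL.not_adj_of_adj_of_notMem hvS huv)
  refine (adj_or_nonempty_subdividers_of_reachable hKL.left_le hind hac hc hK
    (hxa.symm.reachable.trans ((hKL.left_reachable hxS hyS).trans hyc.reachable))).resolve_right ?_
  rintro ⟨w, hw⟩
  exact notMem_subdividers_of_triangle h hab hbc hac.symm ha hb hc hx hy
    (subdividers_comm G a c ▸ hw)

lemma adj_and_adj_of_subdivided_path (h : 2 ≤ genConnectivity 3 G)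
    (hind : G.IsIndepSet {x | G.degree x = 2})
    (hhub : ∀ v, G.degree v ≠ 2 ↔ v ∈ ({a, b, c, d} : Set V)) (hab : a ≠ b) (hac : a ≠ c)
    (hbc : b ≠ c) (hbd : b ≠ d) (hcd : c ≠ d) (hx : x ∈ subdividers G a b)
    (hy : y ∈ subdividers G b c) (hz : z ∈ subdividers G c d) : G.Adj a c ∧ G.Adj b d := by
  have hxy : x ≠ y := ne_of_mem_subdividers hab hbc (by grind) hx hy
  have hxz : x ≠ z := ne_of_mem_subdividers hab hcd (by grind) hx hz
  have hyz : y ≠ z := ne_of_mem_subdividers hbc hcd (by grind) hy hz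
  obtain ⟨K, L, hKL⟩ := doublyJoined_triple h hxy hxz hyz
  have hdeg : ∀ v ∈ ({x, y, z} : Set V), G.degree v = 2 := by
    rintro v (rfl | rfl | rfl)
    exacts [(mem_subdividers.1 hx).1, (mem_subdividers.1 hy).1, (mem_subdividers.1 hz).1]
  have hS : ({x, y, z} : Set V).Nontrivial := ⟨x, by simp, y, by simp, hxy⟩
  wlog hxK : K.Adj x a ∧ L.Adj x b generalizing K L
  · exact this L K hKL.symm
      ((hKL.adj_of_mem_subdividers hS (by simp) hab hx).resolve_left hxK)
  have hbS : b ∉ ({x, y, z} : Set V) := fun hb => (hhub b).2 (by simp) (hdeg b hb)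
  have hcS : c ∉ ({x, y, z} : Set V) := fun hc => (hhub c).2 (by simp) (hdeg c hc)
  have hyL : L.Adj y b ∧ K.Adj y c :=
    (hKL.adj_of_mem_subdividers hS (by simp) hbc hy).resolve_left fun hy =>
      hKL.not_adj_of_adj_of_notMem hbS hy.1 hxK.2
  have hzK : K.Adj z c ∧ L.Adj z d :=
    (hKL.adj_of_mem_subdividers hS (by simp) hcd hz).resolve_right fun hz =>
      hKL.not_adj_of_adj_of_notMem hcS hyL.2 hz.1
  refine ⟨hKL.adj_of_subdivided_path h hind hhub hdeg hab hac hbc (by simp) (by simp) hx hy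
    hxK.1 hxK.2 hyL.2 hzK.2, ?_⟩
  rw [subdividers_comm] at hy hz
  exact (hKL.symm.adj_of_subdivided_path h hind (fun v => (hhub v).trans (by grind)) hdeg hcd.symm
    hbd.symm hbc.symm (by simp) (by simp) hz hy hzK.2 hzK.1 hyL.1 hxK.1).symm

lemma sum_lt_five_of_forall_path {s : Fin 4 → Fin 4 → ℕ} (hcomm : ∀ i j, s i j = s j i)
    (hle : ∀ i j, i ≠ j → s i j < 3) (hsum : ∀ i, ∑ j with j ≠ i, s i j ≤ 3)
    (hpath : ∀ i : Fin 4 → Fin 4, i.Injective →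
      s (i 0) (i 1) = 0 ∨ s (i 1) (i 2) = 0 ∨ s (i 2) (i 3) = 0) :
    ∑ i, ∑ j with i < j, s i j < 5 := by
  have hsum0 : s 0 1 + s 0 2 + s 0 3 ≤ 3 := by
    simpa [Finset.sum_filter, Fin.sum_univ_four] using hsum 0
  have hsum1 : s 1 0 + s 1 2 + s 1 3 ≤ 3 := by
    simpa [Finset.sum_filter, Fin.sum_univ_four] using hsum 1
  have hsum2 : s 2 0 + s 2 1 + s 2 3 ≤ 3 := by
    simpa [Finset.sum_filter, Fin.sum_univ_four] using hsum 2
  have hsum3 : s 3 0 + s 3 1 + s 3 2 ≤ 3 := by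
    simpa [Finset.sum_filter, Fin.sum_univ_four] using hsum 3
  have htotal : ∑ i, ∑ j with i < j, s i j =
      s 0 1 + s 0 2 + s 0 3 + (s 1 2 + s 1 3) + s 2 3 := by
    simp [Finset.sum_filter, Fin.sum_univ_four]
  have h0123 : s 0 1 = 0 ∨ s 1 2 = 0 ∨ s 2 3 = 0 := hpath ![0, 1, 2, 3] (by decide)
  have h0132 : s 0 1 = 0 ∨ s 1 3 = 0 ∨ s 3 2 = 0 := hpath ![0, 1, 3, 2] (by decide)
  have h0213 : s 0 2 = 0 ∨ s 2 1 = 0 ∨ s 1 3 = 0 := hpath ![0, 2, 1, 3] (by decide)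
  have h0231 : s 0 2 = 0 ∨ s 2 3 = 0 ∨ s 3 1 = 0 := hpath ![0, 2, 3, 1] (by decide)
  have h0312 : s 0 3 = 0 ∨ s 3 1 = 0 ∨ s 1 2 = 0 := hpath ![0, 3, 1, 2] (by decide)
  have h0321 : s 0 3 = 0 ∨ s 3 2 = 0 ∨ s 2 1 = 0 := hpath ![0, 3, 2, 1] (by decide)
  have h1023 : s 1 0 = 0 ∨ s 0 2 = 0 ∨ s 2 3 = 0 := hpath ![1, 0, 2, 3] (by decide)
  have h1032 : s 1 0 = 0 ∨ s 0 3 = 0 ∨ s 3 2 = 0 := hpath ![1, 0, 3, 2] (by decide)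
  have h1203 : s 1 2 = 0 ∨ s 2 0 = 0 ∨ s 0 3 = 0 := hpath ![1, 2, 0, 3] (by decide)
  have h1302 : s 1 3 = 0 ∨ s 3 0 = 0 ∨ s 0 2 = 0 := hpath ![1, 3, 0, 2] (by decide)
  have h2013 : s 2 0 = 0 ∨ s 0 1 = 0 ∨ s 1 3 = 0 := hpath ![2, 0, 1, 3] (by decide)
  have h2103 : s 2 1 = 0 ∨ s 1 0 = 0 ∨ s 0 3 = 0 := hpath ![2, 1, 0, 3] (by decide)
  rw [htotal]
  grind

section Hubs

variable {ι : Type*} [Fintype ι] [LinearOrder ι] {hub : ι → V}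

lemma sum_card_subdividers_le_degree (hhub : hub.Injective) (i : ι) :
    ∑ j with j ≠ i, (subdividers G (hub i) (hub j)).card ≤ G.degree (hub i) := by
  classical
  rw [← Finset.card_biUnion, ← card_neighborFinset_eq_degree]
  · refine Finset.card_le_card (Finset.biUnion_subset.2 fun j _ w hw => ?_)
    exact (mem_neighborFinset ..).2 (mem_subdividers.1 hw).2.1.symm
  · intro j hj k hk hjk
    have hij : hub i ≠ hub j := hhub.ne (Finset.mem_filter.1 hj).2.symm
    have hik : hub i ≠ hub k := hhub.ne (Finset.mem_filter.1 hk).2.symm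
    have hjk := hhub.ne hjk
    exact Finset.disjoint_left.2 fun w hwj hwk =>
      ne_of_mem_subdividers hij hik (by grind) hwj hwk rfl

lemma card_degree_eq_two_le_sum_card_subdividers (hind : G.IsIndepSet {x | G.degree x = 2})
    (hhub : ∀ v, G.degree v ≠ 2 → v ∈ Set.range hub) :
    ({x | G.degree x = 2} : Finset V).card ≤
      ∑ i, ∑ j with i < j, (subdividers G (hub i) (hub j)).card := by
  classical
  have hcover : ({x | G.degree x = 2} : Finset V) ⊆
      .biUnion .univ fun i => .biUnion {j | i < j} fun j => subdividers G (hub i) (hub j) := by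
    intro x hx
    obtain ⟨p, q, hpq, hp, hq, hx⟩ := exists_mem_subdividers hind (Finset.mem_filter.1 hx).2
    obtain ⟨i, rfl⟩ := hhub p hp
    obtain ⟨j, rfl⟩ := hhub q hq
    simp only [Finset.mem_biUnion, Finset.mem_filter, Finset.mem_univ, true_and]
    obtain hij | hji := lt_or_gt_of_ne (ne_of_apply_ne hub hpq)
    · exact ⟨i, j, hij, hx⟩
    · exact ⟨j, i, hji, subdividers_comm G _ _ ▸ hx⟩
  exact (Finset.card_le_card hcover).trans <| Finset.card_biUnion_le.trans <|
    Finset.sum_le_sum fun i _ => Finset.card_biUnion_le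

end Hubs

variable {hub : Fin 4 → V}

-- A path of three subdivided edges forces two further edges between hubs, and there is only room
-- for one.
lemma card_subdividers_eq_zero_of_path (h : 2 ≤ genConnectivity 3 G)
    (hind : G.IsIndepSet {x | G.degree x = 2})
    (he : G.edgeFinset.card ≤ 2 * ({x | G.degree x = 2} : Finset V).card + 1)
    (hinj : hub.Injective) (hhub : ∀ v, G.degree v ≠ 2 ↔ v ∈ Set.range hub) :
    (subdividers G (hub 0) (hub 1)).card = 0 ∨ (subdividers G (hub 1) (hub 2)).card = 0 ∨
      (subdividers G (hub 2) (hub 3)).card = 0 := by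
  classical
  by_contra! hcon
  simp only [Finset.card_ne_zero] at hcon
  obtain ⟨⟨x, hx⟩, ⟨y, hy⟩, ⟨z, hz⟩⟩ := hcon
  have hrange : Set.range hub = {hub 0, hub 1, hub 2, hub 3} := by
    ext
    simp [Fin.exists_fin_succ, eq_comm]
  obtain ⟨h02, h13⟩ := adj_and_adj_of_subdivided_path h hind (hrange ▸ hhub)
    (hinj.ne (by decide)) (hinj.ne (by decide)) (hinj.ne (by decide)) (hinj.ne (by decide))
    (hinj.ne (by decide)) hx hy hz
  have hcard := two_mul_card_add_card_le_card_edgeFinset (G := G) (D := {x | G.degree x = 2})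
    (F := {s(hub 0, hub 2), s(hub 1, hub 3)}) (by simp) (by simpa using hind)
    (by simp [Finset.insert_subset_iff, h02, h13]) (by
      have hdeg (i : Fin 4) : G.degree (hub i) ≠ 2 := (hhub _).2 ⟨i, rfl⟩
      simp [hdeg])
  rw [Finset.card_pair (by simp [hinj.eq_iff])] at hcard
  omega

lemma card_degree_eq_two_lt_five (h : 2 ≤ genConnectivity 3 G)
    (hind : G.IsIndepSet {x | G.degree x = 2}) (hdeg : ∀ v, G.degree v ≤ 3)
    (he : G.edgeFinset.card ≤ 2 * ({x | G.degree x = 2} : Finset V).card + 1)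
    (hinj : hub.Injective) (hhub : ∀ v, G.degree v ≠ 2 ↔ v ∈ Set.range hub) :
    ({x | G.degree x = 2} : Finset V).card < 5 := by
  refine (card_degree_eq_two_le_sum_card_subdividers hind fun v => (hhub v).1).trans_lt ?_
  refine sum_lt_five_of_forall_path (fun i j => by rw [subdividers_comm]) (fun i j hij => ?_)
    (fun i => (sum_card_subdividers_le_degree hinj i).trans (hdeg _)) (fun σ hσ => ?_)
  · obtain ⟨k, hki, hkj⟩ : ∃ k, k ≠ i ∧ k ≠ j := by decide +revert
    exact card_subdividers_lt_three h (hinj.ne hij) ((hhub _).2 ⟨k, rfl⟩) (hinj.ne hki)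
      (hinj.ne hkj) (hdeg _) (hdeg _)
  · refine card_subdividers_eq_zero_of_path h hind he (hub := hub ∘ σ) (hinj.comp hσ) fun v => ?_
    rw [hhub, (Finite.injective_iff_surjective.1 hσ).range_comp]

lemma degree_le_three_of_two_mul_card_edgeFinset_add_le (hdeg : ∀ v, 2 ≤ G.degree v)
    (he : 2 * G.edgeFinset.card + ({x | G.degree x = 2} : Finset V).card ≤ 3 * Fintype.card V)
    (v : V) : G.degree v ≤ 3 := by
  rw [← G.sum_degrees_eq_twice_card_edges, Finset.card_filter, ← Finset.sum_add_distrib] at he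
  by_contra! hv
  have : ∑ _v : V, 3 < ∑ v, (G.degree v + if G.degree v = 2 then 1 else 0) :=
    Finset.sum_lt_sum (fun v _ => by have := hdeg v; split_ifs <;> omega)
      ⟨v, Finset.mem_univ v, by omega⟩
  simp only [Finset.sum_const, Finset.card_univ, smul_eq_mul] at this
  omega

lemma card_add_three_le_card_edgeFinset (h : 2 ≤ genConnectivity 3 G)
    (hV : Fintype.card V = 9 ∨ Fintype.card V = 10) :
    Fintype.card V + 3 ≤ G.edgeFinset.card := by
  by_contra! hlt
  have hdeg := two_le_degree (by norm_num) (by omega) h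
  have hind := isIndepSet_degree_eq_two le_rfl (by omega) h
  have hsum := three_mul_card_le_two_mul_card_edgeFinset_add hdeg
  classical
  have htwo := two_mul_card_add_card_le_card_edgeFinset (G := G)
    (D := {x | G.degree x = 2}) (F := ∅) (by simp) (by simpa using hind) (by simp) (by simp)
  have hhubs : Fintype.card {v // G.degree v ≠ 2} = 4 := by
    have hcompl := Fintype.card_subtype_compl fun v => G.degree v = 2
    rw [Fintype.card_subtype fun v => G.degree v = 2] at hcompl
    simp only [ne_eq, Finset.card_empty] at htwo ⊢
    omega
  set hub := (Fintype.equivFinOfCardEq hhubs).symm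
  have hfive := card_degree_eq_two_lt_five h hind
    (degree_le_three_of_two_mul_card_edgeFinset_add_le hdeg (by omega)) (by omega)
    (hub := Subtype.val ∘ hub) (Subtype.val_injective.comp hub.injective)
    (fun v => by rw [hub.surjective.range_comp, Subtype.range_coe_subtype, Set.mem_ofPred_eq])
  omega

end FourHubs

section EdgeReplacement

variable {V W : Type*} {G K L : SimpleGraph V} {H : SimpleGraph W} {S : Set V} {f : V → W}
  {P : V → V → SimpleGraph W}

/-- The graph obtained from `K` by replacing every edge `xy` by the graph `P x y ⊔ P y x`. -/
def replaceEdges (P : V → V → SimpleGraph W) (K : SimpleGraph V) : SimpleGraph W :=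
  ⨆ x, ⨆ y, ⨆ _ : K.Adj x y, P x y

lemma replaceEdges_adj {u v : W} :
    (replaceEdges P K).Adj u v ↔ ∃ x y, K.Adj x y ∧ (P x y).Adj u v := by
  simp [replaceEdges]

lemma replaceEdges_reachable
    (hreach : ∀ x y, K.Adj x y → (P x y ⊔ P y x).Reachable (f x) (f y)) {x y : V}
    (hxy : K.Reachable x y) : (replaceEdges P K).Reachable (f x) (f y) :=
  reachable_of_forall_adj_reachable f (fun x y hadj => (hreach x y hadj).mono <|
    sup_le (fun _ _ h => replaceEdges_adj.2 ⟨x, y, hadj, h⟩)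
      (fun _ _ h => replaceEdges_adj.2 ⟨y, x, hadj.symm, h⟩)) hxy

lemma DoublyJoined.image_of_replaceEdges_le (hle : replaceEdges P G ≤ H)
    (hreach : ∀ x y, G.Adj x y → (P x y ⊔ P y x).Reachable (f x) (f y))
    (hmeet : ∀ x y x' y', G.Adj x y → G.Adj x' y' → s(x, y) ≠ s(x', y') → ∀ w u u',
      (P x y).Adj w u → (P x' y').Adj w u' → ∃ z, f z = w ∧ z ∈ s(x, y) ∧ z ∈ s(x', y')) :
    DoublyJoined G S → DoublyJoined H (f '' S) := by
  rintro ⟨K, L, h⟩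
  have le {K : SimpleGraph V} (hK : K ≤ G) : replaceEdges P K ≤ H := fun u v huv => by
    obtain ⟨x, y, hxy, huv⟩ := replaceEdges_adj.1 huv
    exact hle (replaceEdges_adj.2 ⟨x, y, hK hxy, huv⟩)
  have meet {x y x' y' : V} (hK : K.Adj x y) (hL : L.Adj x' y') {w u u' : W}
      (hu : (P x y).Adj w u) (hu' : (P x' y').Adj w u') :
      ∃ z, f z = w ∧ z ∈ s(x, y) ∧ z ∈ s(x', y') := by
    refine hmeet x y x' y' (h.left_le hK) (h.right_le hL) (fun heq => ?_) w u u' hu hu'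
    exact h.not_adj hK (show s(x, y) ∈ L.edgeSet from heq ▸ hL)
  refine ⟨_, _, le h.left_le, le h.right_le, fun u v hK hL => ?_, fun u v w hK hL => ?_, ?_, ?_⟩
  · obtain ⟨x, y, hxy, huv⟩ := replaceEdges_adj.1 hK
    obtain ⟨x', y', hxy', huv'⟩ := replaceEdges_adj.1 hL
    obtain ⟨z, rfl, hz, hz'⟩ := meet hxy hxy' huv huv'
    obtain ⟨t, rfl, ht, ht'⟩ := meet hxy hxy' huv.symm huv'.symm
    have hzt : z ≠ t := ne_of_apply_ne f huv.ne
    have heq := (Sym2.mem_and_mem_iff hzt).1 ⟨hz', ht'⟩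
    rw [← (Sym2.mem_and_mem_iff hzt).1 ⟨hz, ht⟩] at heq
    exact h.not_adj hxy (show s(x, y) ∈ L.edgeSet from heq ▸ hxy')
  · obtain ⟨x, y, hxy, huv⟩ := replaceEdges_adj.1 hK
    obtain ⟨x', y', hxy', huw⟩ := replaceEdges_adj.1 hL
    obtain ⟨z, rfl, ⟨t, hzt⟩, ⟨t', hzt'⟩⟩ := meet hxy hxy' huv huw
    exact ⟨z, h.mem_of_adj (show s(z, t) ∈ K.edgeSet from hzt ▸ hxy)
      (show s(z, t') ∈ L.edgeSet from hzt' ▸ hxy'), rfl⟩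
  · rintro _ ⟨x, hx, rfl⟩ _ ⟨y, hy, rfl⟩
    exact replaceEdges_reachable (fun x y hxy => hreach x y (h.left_le hxy))
      (h.left_reachable hx hy)
  · rintro _ ⟨x, hx, rfl⟩ _ ⟨y, hy, rfl⟩
    exact replaceEdges_reachable (fun x y hxy => hreach x y (h.right_le hxy))
      (h.right_reachable hx hy)

lemma DoublyJoined.image_of_injOn (hf : Set.InjOn f G.support)
    (hH : ∀ x y, G.Adj x y → H.Adj (f x) (f y)) :
    DoublyJoined G S → DoublyJoined H (f '' S) := by
  refine image_of_replaceEdges_le (P := fun x y => edge (f x) (f y)) (fun u v huv => ?_)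
    (fun x y hxy => ?_) fun x y x' y' hxy hxy' _ w u u' hu hu' => ?_
  · obtain ⟨x, y, hxy, huv⟩ := replaceEdges_adj.1 huv
    obtain ⟨⟨rfl, rfl⟩ | ⟨rfl, rfl⟩, -⟩ := edge_adj .. |>.1 huv
    exacts [hH x y hxy, (hH x y hxy).symm]
  · exact Adj.reachable (.inl (edge_adj .. |>.2 ⟨.inl ⟨rfl, rfl⟩, (hH x y hxy).ne⟩))
  · have hx : x ∈ G.support := ⟨y, hxy⟩
    have hy : y ∈ G.support := ⟨x, hxy.symm⟩
    have hx' : x' ∈ G.support := ⟨y', hxy'⟩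
    have hy' : y' ∈ G.support := ⟨x', hxy'.symm⟩
    rw [edge_adj] at hu hu'
    simp only [Sym2.mem_iff]
    grind [Set.InjOn]

end EdgeReplacement

section Suppress

variable {V : Type*} {G K : SimpleGraph V} {S W : Set V}

/-- The graph obtained from `G` by deleting the vertices in `W` and joining any two neighbours of
a deleted vertex, which suppresses `W` if it consists of vertices of degree two. The vertex type
is kept, with the vertices in `W` isolated. -/
def suppress (G : SimpleGraph V) (W : Set V) : SimpleGraph V where
  Adj x y := x ≠ y ∧ x ∉ W ∧ y ∉ W ∧ (G.Adj x y ∨ ∃ w ∈ W, G.Adj w x ∧ G.Adj w y)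
  symm := ⟨fun x y => by simp only [ne_comm, adj_comm]; tauto⟩
  loopless := ⟨fun x h => h.1 rfl⟩

@[simp]
lemma suppress_empty : suppress G ∅ = G := by
  ext
  simpa [suppress] using Adj.ne

lemma suppress_mono (h : K ≤ G) : suppress K W ≤ suppress G W :=
  fun _ _ ⟨hne, hx, hy, hxy⟩ => ⟨hne, hx, hy, hxy.imp (@h _ _)
    fun ⟨w, hw, hwx, hwy⟩ => ⟨w, hw, h hwx, h hwy⟩⟩

lemma exists_adj_of_suppress_adj {x y : V} : (suppress G W).Adj x y → ∃ z, G.Adj x z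
  | ⟨_, _, _, .inl h⟩ => ⟨y, h⟩
  | ⟨_, _, _, .inr ⟨w, _, h, _⟩⟩ => ⟨w, h.symm⟩

lemma suppress_reachable (hW : K.IsIndepSet W) {x y : V} (h : K.Reachable x y) (hx : x ∉ W)
    (hy : y ∉ W) : (suppress K W).Reachable x y := by
  obtain ⟨p⟩ := h
  suffices (x ∉ W → (suppress K W).Reachable x y) ∧
      (x ∈ W → ∀ z, K.Adj x z → (suppress K W).Reachable z y) from this.1 hx
  clear hx
  induction p with
  | nil => exact ⟨fun _ => .rfl, fun hx => absurd hx hy⟩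
  | @cons x v y hxv p ih =>
    obtain ⟨ih, ih'⟩ := ih hy
    refine ⟨fun hx => ?_, fun hx z hxz => ?_⟩
    · by_cases hv : v ∈ W
      · exact ih' hv x hxv.symm
      · have hadj : (suppress K W).Adj x v := ⟨hxv.ne, hx, hv, .inl hxv⟩
        exact hadj.reachable.trans (ih hv)
    · have hnot {u : V} (hu : K.Adj x u) : u ∉ W := fun huW => hW hx huW hu.ne hu
      obtain rfl | hzv := eq_or_ne z v
      · exact ih (hnot hxv)
      · have hadj : (suppress K W).Adj z v :=
          ⟨hzv, hnot hxz, hnot hxv, .inr ⟨x, hx, hxz, hxv⟩⟩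
        exact hadj.reachable.trans (ih (hnot hxv))

-- The last two hypotheses say that suppressing `W` creates no multiple edges.
lemma doublyJoined_suppress (hS : Disjoint S W) (hW : G.IsIndepSet W)
    (hadj : ∀ w ∈ W, ∀ x y, G.Adj w x → G.Adj w y → ¬ G.Adj x y)
    (hunique : ∀ w ∈ W, ∀ w' ∈ W, ∀ x y, x ≠ y → G.Adj w x → G.Adj w y → G.Adj w' x →
      G.Adj w' y → w = w') :
    DoublyJoined G S → DoublyJoined (suppress G W) S := by
  rintro ⟨K, L, h⟩
  have hreach {K : SimpleGraph V} (hK : K ≤ G)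
      (h : ∀ ⦃x⦄, x ∈ S → ∀ ⦃y⦄, y ∈ S → K.Reachable x y) ⦃x : V⦄ (hx : x ∈ S) ⦃y : V⦄
      (hy : y ∈ S) : (suppress K W).Reachable x y :=
    suppress_reachable (fun u hu v hv huv => mt (@hK u v) (hW hu hv huv)) (h hx hy)
      (hS.notMem_of_mem_left hx) (hS.notMem_of_mem_left hy)
  refine ⟨_, _, suppress_mono h.left_le, suppress_mono h.right_le, ?_, fun x y z hK hL => ?_,
    hreach h.left_le h.left_reachable, hreach h.right_le h.right_reachable⟩
  · rintro x y ⟨hxy, -, -, hK | ⟨w, hw, hwx, hwy⟩⟩ ⟨-, -, -, hL | ⟨w', hw', hwx', hwy'⟩⟩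
    · exact h.not_adj hK hL
    · exact hadj w' hw' x y (h.right_le hwx') (h.right_le hwy') (h.left_le hK)
    · exact hadj w hw x y (h.left_le hwx) (h.left_le hwy) (h.right_le hL)
    · obtain rfl := hunique w hw w' hw' x y hxy (h.left_le hwx) (h.left_le hwy) (h.right_le hwx')
        (h.right_le hwy')
      exact hS.notMem_of_mem_left (h.mem_of_adj hwx hwx') hw
  · obtain ⟨_, hK⟩ := exists_adj_of_suppress_adj hK
    obtain ⟨_, hL⟩ := exists_adj_of_suppress_adj hL
    exact h.mem_of_adj hK hL

end Suppress

section Colouring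

variable {V : Type*} [LinearOrder V] {G : SimpleGraph V} {C : V → Bool} {S : Set V}

/-- The subgraph of `G` consisting of the edges of colour `b`, for a 2-colouring `C` of the
vertices: both ends have colour `b` or lie in `S`. An edge inside `S` takes the colour of its
smaller end, so that the two colour classes are disjoint. -/
def colourPart (G : SimpleGraph V) (C : V → Bool) (S : Set V) (b : Bool) : SimpleGraph V where
  Adj x y := G.Adj x y ∧ (C x = b ∨ x ∈ S) ∧ (C y = b ∨ y ∈ S) ∧
    (x ∈ S → y ∈ S → C (min x y) = b)
  symm := ⟨fun x y => by simp only [adj_comm, min_comm]; tauto⟩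
  loopless := ⟨fun _ h => h.1.ne rfl⟩

lemma isJoiningPair_colourPart
    (h : ∀ b, ∀ x ∈ S, ∀ y ∈ S, (colourPart G C S b).Reachable x y) :
    IsJoiningPair G S (colourPart G C S true) (colourPart G C S false) where
  left_le _ _ h := h.1
  right_le _ _ h := h.1
  not_adj x y := by rintro ⟨-, hx, hy, hxy⟩ ⟨-, hx', hy', hxy'⟩; grind
  mem_of_adj x y z := by rintro ⟨-, hx, -⟩ ⟨-, hx', -⟩; grind
  left_reachable _ hx _ hy := h true _ hx _ hy
  right_reachable _ hx _ hy := h false _ hx _ hy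

end Colouring

section Search

variable {G K : SimpleGraph ℕ} {E F : List (ℕ × ℕ)} {S : Finset ℕ} {R M a : ℕ}

/-- Add the ends of `e` to the set `R` if `e` meets `R`. A finite set of natural numbers is encoded
by the number whose binary digits are its indicator function. -/
def spread (R : ℕ) (e : ℕ × ℕ) : ℕ :=
  bif R.testBit e.1 || R.testBit e.2 then R ||| 2 ^ e.1 ||| 2 ^ e.2 else R

/-- Whether `S` is contained in the set of vertices that can be reached from `R` by passing through
the list `F` of edges back and forth at most `n` times. -/
def spreadsTo (S : Finset ℕ) : ℕ → List (ℕ × ℕ) → ℕ → Bool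
  | 0, _, _ => false
  | n + 1, F, R => (∀ x ∈ S, R.testBit x) ||
      (F.foldl spread R != R && spreadsTo S n F.reverse (F.foldl spread R))

/-- The edges from the list `E` that belong to `colourPart _ M.testBit S b`. -/
def colourClass (E : List (ℕ × ℕ)) (M : ℕ) (S : Finset ℕ) (b : Bool) : List (ℕ × ℕ) :=
  E.filter fun (x, y) => (M.testBit x = b ∨ x ∈ S) ∧ (M.testBit y = b ∨ y ∈ S) ∧
    (x ∈ S → y ∈ S → M.testBit (min x y) = b)

lemma reachable_of_testBit_foldl_spread (hF : ∀ e ∈ F, K.Adj e.1 e.2)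
    (hR : ∀ x, R.testBit x → K.Reachable a x) :
    ∀ x, (F.foldl spread R).testBit x → K.Reachable a x := by
  induction F generalizing R with
  | nil => exact hR
  | cons e F ih =>
    obtain ⟨he, hF⟩ := List.forall_mem_cons.1 hF
    refine ih hF fun x hx => ?_
    rw [spread, Bool.cond_eq_ite] at hx
    split_ifs at hx with hmeets
    · have hends : K.Reachable a e.1 ∧ K.Reachable a e.2 := by
        obtain h | h := Bool.or_eq_true _ _ ▸ hmeets
        · exact ⟨hR _ h, (hR _ h).trans he.reachable⟩
        · exact ⟨(hR _ h).trans he.symm.reachable, hR _ h⟩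
      simp only [Nat.testBit_or, Nat.testBit_two_pow, Bool.or_eq_true, decide_eq_true_eq] at hx
      obtain (hx | rfl) | rfl := hx
      exacts [hR x hx, hends.1, hends.2]
    · exact hR x hx

lemma reachable_of_spreadsTo {n : ℕ} (hF : ∀ e ∈ F, K.Adj e.1 e.2)
    (hR : ∀ x, R.testBit x → K.Reachable a x) (h : spreadsTo S n F R) :
    ∀ x ∈ S, K.Reachable a x := by
  induction n generalizing F R with
  | zero => simp [spreadsTo] at h
  | succ n ih =>
    simp only [spreadsTo, Bool.or_eq_true, decide_eq_true_eq, Bool.and_eq_true] at h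
    obtain h | ⟨-, h⟩ := h
    · exact fun x hx => hR x (h x hx)
    · exact ih (by simpa using hF) (reachable_of_testBit_foldl_spread hF hR) h

lemma doublyJoined_of_spreadsTo {n : ℕ} (hE : ∀ e ∈ E, G.Adj e.1 e.2)
    (h : ∀ b, spreadsTo S n (colourClass E M S b) (2 ^ a)) : DoublyJoined G S := by
  refine ⟨_, _, isJoiningPair_colourPart (C := M.testBit) fun b x hx y hy => ?_⟩
  have hadj : ∀ e ∈ colourClass E M S b, (colourPart G M.testBit S b).Adj e.1 e.2 := fun e he => by
    obtain ⟨heE, he⟩ := List.mem_filter.1 he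
    exact ⟨hE e heE, of_decide_eq_true he⟩
  have hstart : ∀ x, (2 ^ a).testBit x → (colourPart G M.testBit S b).Reachable a x := by
    simp [Nat.testBit_two_pow]
  have hreach := reachable_of_spreadsTo hadj hstart (h b)
  exact (hreach x hx).symm.trans (hreach y hy)

end Search

section MobiusLadder

variable {k m x y : ℕ}

/-- The vertices of `subdividedMobius k` that subdivide edges of the Möbius ladder. -/
def links (k : ℕ) : Finset ℕ :=
  {x ∈ Finset.range (5 * k) | 2 ≤ x % 5}

/-- The end of the edge subdivided by `x` that comes first along the ladder. -/
def firstEnd (x : ℕ) : ℕ :=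
  if x % 5 = 2 then x - 2 else x - 3

/-- The other end of the edge subdivided by `x`. The last two edges of the rails are crossed. -/
def secondEnd (k x : ℕ) : ℕ :=
  if x % 5 = 2 then x - 1 else if x + 2 < 5 * k then x + 2 else 5 * k - 1 - x

/-- The Möbius ladder with `k` rungs, each edge of which is subdivided once. For `m < k` the ends
of the rung number `m` are `5 * m` and `5 * m + 1`, the rung is subdivided by `5 * m + 2`, and the
edges of the rails that lead to the next rung are subdivided by `5 * m + 3` and `5 * m + 4`. The
vertices `5 * k, 5 * k + 1, …` are isolated. -/
def subdividedMobius (k : ℕ) : SimpleGraph ℕ :=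
  fromRel fun x y => x ∈ links k ∧ (y = firstEnd x ∨ y = secondEnd k x)

lemma mem_links : x ∈ links k ↔ x < 5 * k ∧ 2 ≤ x % 5 := by
  simp [links]

lemma card_links (k : ℕ) : (links k).card = 3 * k := by
  induction k with
  | zero => rfl
  | succ k ih =>
    have : links (k + 1) = links k ∪ {5 * k + 2, 5 * k + 3, 5 * k + 4} := by
      ext
      simp only [mem_links, Finset.mem_union, Finset.mem_insert, Finset.mem_singleton]
      omega
    rw [this, Finset.card_union_of_disjoint, ih] <;>
      simp [mem_links]
    ring

lemma firstEnd_lt_and_mod_lt (hx : x ∈ links k) : firstEnd x < 5 * k ∧ firstEnd x % 5 < 2 := by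
  rw [mem_links] at hx
  grind [firstEnd]

lemma secondEnd_lt_and_mod_lt (hx : x ∈ links k) :
    secondEnd k x < 5 * k ∧ secondEnd k x % 5 < 2 := by
  rw [mem_links] at hx
  grind [secondEnd]

lemma firstEnd_ne_secondEnd (hx : x ∈ links k) : firstEnd x ≠ secondEnd k x := by
  rw [mem_links] at hx
  grind [firstEnd, secondEnd]

lemma subdividedMobius_adj :
    (subdividedMobius k).Adj x y ↔ (x ∈ links k ∧ (y = firstEnd x ∨ y = secondEnd k x)) ∨
      (y ∈ links k ∧ (x = firstEnd y ∨ x = secondEnd k y)) := by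
  rw [subdividedMobius, fromRel_adj, and_iff_right_iff_imp]
  have hne {x y : ℕ} (hx : x ∈ links k) (hy : y = firstEnd x ∨ y = secondEnd k x) : x ≠ y := by
    have := firstEnd_lt_and_mod_lt hx
    have := secondEnd_lt_and_mod_lt hx
    rw [mem_links] at hx
    grind
  rintro (⟨hx, hy⟩ | ⟨hy, hx⟩)
  exacts [hne hx hy, (hne hy hx).symm]

lemma subdividedMobius_adj_of_mem_links (hx : x ∈ links k) :
    (subdividedMobius k).Adj x y ↔ y = firstEnd x ∨ y = secondEnd k x := by
  have hne (hy : y ∈ links k) : ¬ (x = firstEnd y ∨ x = secondEnd k y) := by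
    have := firstEnd_lt_and_mod_lt hy
    have := secondEnd_lt_and_mod_lt hy
    rw [mem_links] at hx
    grind
  rw [subdividedMobius_adj]
  tauto

lemma lt_and_lt_of_subdividedMobius_adj (h : (subdividedMobius k).Adj x y) :
    x < 5 * k ∧ y < 5 * k := by
  wlog hx : x ∈ links k generalizing x y
  · exact (this h.symm ((subdividedMobius_adj.1 h).resolve_left fun h => hx h.1).1).symm
  have := firstEnd_lt_and_mod_lt hx
  have := secondEnd_lt_and_mod_lt hx
  have hy := (subdividedMobius_adj_of_mem_links hx).1 h
  rw [mem_links] at hx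
  grind

/-- Renumbers the vertices of `subdividedMobius k` when a new rung is inserted at position `m`. -/
def insertRung (m x : ℕ) : ℕ :=
  if x < 5 * m then x else x + 5

lemma insertRung_injective (m : ℕ) : (insertRung m).Injective := by
  intro x y
  grind [insertRung]

lemma insertRung_mem_links (m : ℕ) (hx : x ∈ links k) : insertRung m x ∈ links (k + 1) := by
  rw [mem_links] at *
  grind [insertRung]

lemma insertRung_firstEnd (m x : ℕ) (hx : 2 ≤ x % 5) :
    insertRung m (firstEnd x) = firstEnd (insertRung m x) := by
  grind [insertRung, firstEnd]

lemma insertRung_secondEnd (hm : m ≤ k) (hx : x ∈ links k)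
    (hxm : secondEnd (k + 1) (insertRung m x) / 5 ≠ m) :
    insertRung m (secondEnd k x) = secondEnd (k + 1) (insertRung m x) := by
  rw [mem_links] at hx
  grind [insertRung, secondEnd]

lemma insertRung_secondEnd_detour (hm : m ≤ k) (hx : x ∈ links k)
    (hxm : secondEnd (k + 1) (insertRung m x) / 5 = m) :
    firstEnd (secondEnd (k + 1) (insertRung m x) + 3) = secondEnd (k + 1) (insertRung m x) ∧
    secondEnd (k + 1) (secondEnd (k + 1) (insertRung m x) + 3) = insertRung m (secondEnd k x) := by
  rw [mem_links] at hx
  grind [insertRung, secondEnd, firstEnd]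

/-- The vertices of the new rung at position `m`, and of the rails next to it, that have to be
inserted between `x` and `secondEnd k x` if the new rung separates these two vertices. -/
def detour (k m x : ℕ) : Set ℕ :=
  {w | x ∈ links k ∧ secondEnd (k + 1) (insertRung m x) / 5 = m ∧
    (w = secondEnd (k + 1) (insertRung m x) ∨ w = secondEnd (k + 1) (insertRung m x) + 3)}

lemma insertRung_notMem_detour (k m x y : ℕ) : insertRung m y ∉ detour k m x := by
  rintro ⟨hx, hxm, hy⟩
  have := secondEnd_lt_and_mod_lt (insertRung_mem_links m hx)
  grind [insertRung]

lemma eq_of_mem_detour {w : ℕ} (hx : w ∈ detour k m x) (hy : w ∈ detour k m y) : x = y := by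
  obtain ⟨hx, hxm, hw⟩ := hx
  obtain ⟨hy, hym, hw'⟩ := hy
  have := secondEnd_lt_and_mod_lt (insertRung_mem_links m hx)
  have := secondEnd_lt_and_mod_lt (insertRung_mem_links m hy)
  rw [mem_links] at hx hy
  grind [insertRung, secondEnd]

/-- The path between `insertRung m x` and `insertRung m y` that takes the place of the edge `xy` of
`subdividedMobius k` when a new rung is inserted at position `m`. -/
def pathAfterInsertion (k m x y : ℕ) : SimpleGraph ℕ where
  Adj u v := (subdividedMobius (k + 1)).Adj u v ∧
    ∀ w ∈ s(u, v), w = insertRung m x ∨ w = insertRung m y ∨ y = secondEnd k x ∧ w ∈ detour k m x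
  symm := ⟨fun u v => by rw [adj_comm, Sym2.eq_swap]; exact id⟩
  loopless := ⟨fun _ h => h.1.ne rfl⟩

lemma exists_insertRung_eq_of_pathAfterInsertion_adj {x' y' w u u' : ℕ} (hne : s(x, y) ≠ s(x', y'))
    (hw : (pathAfterInsertion k m x y).Adj w u) (hw' : (pathAfterInsertion k m x' y').Adj w u') :
    ∃ z, insertRung m z = w ∧ z ∈ s(x, y) ∧ z ∈ s(x', y') := by
  have hinj := insertRung_injective m
  have hnot := insertRung_notMem_detour k m
  replace hw := hw.2 w (Sym2.mem_mk_left ..)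
  replace hw' := hw'.2 w (Sym2.mem_mk_left ..)
  grind [Function.Injective, eq_of_mem_detour]

lemma pathAfterInsertion_reachable_secondEnd (hm : m ≤ k) (hx : x ∈ links k) :
    (pathAfterInsertion k m x (secondEnd k x)).Reachable (insertRung m x)
      (insertRung m (secondEnd k x)) := by
  have hfx := insertRung_mem_links m hx
  by_cases hxm : secondEnd (k + 1) (insertRung m x) / 5 = m
  · obtain ⟨hfirst, hsecond⟩ := insertRung_secondEnd_detour hm hx hxm
    have hh := secondEnd_lt_and_mod_lt hfx
    set h := secondEnd (k + 1) (insertRung m x)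
    have hlink : h + 3 ∈ links (k + 1) := mem_links.2 (by omega)
    have hmem {w : ℕ} (hw : w = h ∨ w = h + 3) : w ∈ detour k m x := ⟨hx, hxm, hw⟩
    have hxh : (pathAfterInsertion k m x (secondEnd k x)).Adj (insertRung m x) h :=
      ⟨(subdividedMobius_adj_of_mem_links hfx).2 (.inr rfl), by simp [hmem]⟩
    have hlh : (pathAfterInsertion k m x (secondEnd k x)).Adj (h + 3) h :=
      ⟨(subdividedMobius_adj_of_mem_links hlink).2 (.inl hfirst.symm), by simp [hmem]⟩
    have hly : (pathAfterInsertion k m x (secondEnd k x)).Adj (h + 3)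
        (insertRung m (secondEnd k x)) :=
      ⟨(subdividedMobius_adj_of_mem_links hlink).2 (.inr hsecond.symm), by simp [hmem]⟩
    exact hxh.reachable.trans (hlh.symm.reachable.trans hly.reachable)
  · have hadj : (pathAfterInsertion k m x (secondEnd k x)).Adj (insertRung m x)
        (insertRung m (secondEnd k x)) :=
      ⟨(subdividedMobius_adj_of_mem_links hfx).2 (.inr (insertRung_secondEnd hm hx hxm)), by simp⟩
    exact hadj.reachable

lemma pathAfterInsertion_reachable (hm : m ≤ k) (hxy : (subdividedMobius k).Adj x y) :
    (pathAfterInsertion k m x y ⊔ pathAfterInsertion k m y x).Reachable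
      (insertRung m x) (insertRung m y) := by
  wlog hx : x ∈ links k generalizing x y
  · rw [sup_comm]
    exact (this hxy.symm ((subdividedMobius_adj.1 hxy).resolve_left fun h => hx h.1).1).symm
  refine Reachable.mono le_sup_left ?_
  obtain rfl | rfl := (subdividedMobius_adj_of_mem_links hx).1 hxy
  · have hadj : (pathAfterInsertion k m x (firstEnd x)).Adj (insertRung m x)
        (insertRung m (firstEnd x)) :=
      ⟨(subdividedMobius_adj_of_mem_links (insertRung_mem_links m hx)).2
        (.inl (insertRung_firstEnd m x (mem_links.1 hx).2)), by simp⟩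
    exact hadj.reachable
  · exact pathAfterInsertion_reachable_secondEnd hm hx

lemma doublyJoined_image_insertRung {S : Set ℕ} (hm : m ≤ k) :
    DoublyJoined (subdividedMobius k) S →
      DoublyJoined (subdividedMobius (k + 1)) (insertRung m '' S) := by
  refine DoublyJoined.image_of_replaceEdges_le (P := pathAfterInsertion k m) (fun u v huv => ?_)
    (fun x y => pathAfterInsertion_reachable hm)
    fun x y x' y' _ _ hne w u u' => exists_insertRung_eq_of_pathAfterInsertion_adj hne
  obtain ⟨x, y, -, huv⟩ := replaceEdges_adj.1 huv
  exact huv.1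

end MobiusLadder

section TripleJoined

variable {k m : ℕ} {W : Finset ℕ}

/-- Any three vertices in `X` are joined by two subgraphs of `G` that share nothing else; in a
graph with vertex set `X` this is the relation `κ₃(G) ≥ 2`. -/
def TripleJoined {V : Type*} (G : SimpleGraph V) (X : Set V) : Prop :=
  ∀ S : Finset V, (S : Set V) ⊆ X → S.card = 3 → DoublyJoined G S

lemma exists_insertRung_eq {x : ℕ} (hx : x / 5 ≠ m) : ∃ y, insertRung m y = x := by
  obtain h | h := Nat.lt_or_gt_of_ne hx
  · exact ⟨x, by grind [insertRung]⟩
  · exact ⟨x - 5, by grind [insertRung]⟩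

lemma lt_of_insertRung_lt {x : ℕ} (hm : m ≤ k) (hx : insertRung m x < 5 * (k + 1)) : x < 5 * k := by
  grind [insertRung]

lemma exists_le_forall_div_ne {S : Finset ℕ} (hS : S.card ≤ k) : ∃ m ≤ k, ∀ x ∈ S, x / 5 ≠ m := by
  obtain ⟨m, hm, hmS⟩ := Finset.exists_mem_notMem_of_card_lt_card
    (s := S.image (· / 5)) (t := Finset.range (k + 1))
    (by rw [Finset.card_range]; exact Finset.card_image_le.trans_lt (Nat.lt_succ_of_le hS))
  exact ⟨m, Finset.mem_range_succ_iff.1 hm, fun x hx hxm =>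
    hmS (Finset.mem_image.2 ⟨x, hx, hxm⟩)⟩

lemma tripleJoined_subdividedMobius_succ (hk : 3 ≤ k)
    (h : TripleJoined (subdividedMobius k) (Set.Iio (5 * k))) :
    TripleJoined (subdividedMobius (k + 1)) (Set.Iio (5 * (k + 1))) := by
  intro S hSk hS
  obtain ⟨m, hm, hSm⟩ := exists_le_forall_div_ne (hS.trans_le hk)
  have hinj := insertRung_injective m
  obtain ⟨S, rfl⟩ : ∃ T : Finset ℕ, S = T.image (insertRung m) := by
    refine ⟨S.preimage _ hinj.injOn, (Finset.image_preimage_of_bij _ _ ?_).symm⟩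
    exact ⟨fun x hx => hx, hinj.injOn, fun x hx => by
      obtain ⟨y, rfl⟩ := exists_insertRung_eq (hSm x hx)
      exact ⟨y, hx, rfl⟩⟩
  rw [Finset.card_image_of_injective _ hinj] at hS
  rw [Finset.coe_image] at hSk ⊢
  exact doublyJoined_image_insertRung hm
    (h S (fun x hx => lt_of_insertRung_lt hm (hSk ⟨x, hx, rfl⟩)) hS)

lemma tripleJoined_suppress (hk : 2 ≤ k) (hW : W ⊆ links k)
    (h : TripleJoined (subdividedMobius k) (Set.Iio (5 * k))) :
    TripleJoined (suppress (subdividedMobius k) W) (Set.Iio (5 * k) \ W) := by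
  intro S hSW hS
  have hWadj {w : ℕ} (hw : w ∈ (W : Set ℕ)) (x : ℕ) :
      (subdividedMobius k).Adj w x ↔ x = firstEnd w ∨ x = secondEnd k w :=
    subdividedMobius_adj_of_mem_links (hW hw)
  refine doublyJoined_suppress (Set.disjoint_of_subset_left hSW disjoint_sdiff_self_left)
    ?_ ?_ ?_ (h S (hSW.trans Set.sdiff_subset) hS)
  · intro w hw w' hw' _ hadj
    have := firstEnd_lt_and_mod_lt (hW hw)
    have := secondEnd_lt_and_mod_lt (hW hw)
    have := mem_links.1 (hW hw')
    grind
  · intro w hw x y hx hy hxy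
    have := firstEnd_lt_and_mod_lt (hW hw)
    have := secondEnd_lt_and_mod_lt (hW hw)
    have := mem_links (k := k) (x := x)
    have := mem_links (k := k) (x := y)
    rw [subdividedMobius_adj] at hxy
    grind
  · intro w hw w' hw' x y hxy hwx hwy hwx' hwy'
    have h1 := mem_links.1 (hW hw)
    have h2 := mem_links.1 (hW hw')
    rw [hWadj hw] at hwx hwy
    rw [hWadj hw'] at hwx' hwy'
    grind [firstEnd, secondEnd]

/-- The edges of `suppress (subdividedMobius k) W` for `W ⊆ links k`. -/
def ladderEdges (k : ℕ) (W : Finset ℕ) : List (ℕ × ℕ) :=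
  ((List.range (5 * k)).filter fun x => 2 ≤ x % 5).flatMap fun x =>
    if x ∈ W then [(firstEnd x, secondEnd k x)] else [(x, firstEnd x), (x, secondEnd k x)]

lemma suppress_adj_of_mem_ladderEdges (hW : W ⊆ links k) :
    ∀ e ∈ ladderEdges k W, (suppress (subdividedMobius k) W).Adj e.1 e.2 := by
  intro e he
  obtain ⟨x, hx, he⟩ := List.mem_flatMap.1 he
  replace hx : x ∈ links k := by simpa [mem_links] using hx
  have hnotMem {y : ℕ} (hy : y % 5 < 2) : y ∉ W := fun hyW =>
    (mem_links.1 (hW hyW)).2.not_gt hy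
  have hfirst := hnotMem (firstEnd_lt_and_mod_lt hx).2
  have hsecond := hnotMem (secondEnd_lt_and_mod_lt hx).2
  have hxfirst := (subdividedMobius_adj_of_mem_links hx).2 (.inl rfl)
  have hxsecond := (subdividedMobius_adj_of_mem_links hx).2 (.inr rfl)
  split_ifs at he with hxW
  · obtain rfl := List.mem_singleton.1 he
    exact ⟨firstEnd_ne_secondEnd hx, hfirst, hsecond, .inr ⟨x, hxW, hxfirst, hxsecond⟩⟩
  · obtain rfl | rfl := List.mem_pair.1 he
    · exact ⟨hxfirst.ne, hxW, hfirst, .inl hxfirst⟩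
    · exact ⟨hxsecond.ne, hxW, hsecond, .inl hxsecond⟩

-- In the applications `l` lists, as bit masks, 2-colourings found by a computer search, among which
-- every triple `S` has one whose two colour classes both connect `S`.
lemma tripleJoined_of_spreadsTo (hW : W ⊆ links k) (l : List ℕ)
    (h : ∀ S ∈ (Finset.range (5 * k) \ W).powersetCard 3, ∃ M ∈ l, ∀ b,
      spreadsTo S 6 (colourClass (ladderEdges k W) M S b) (2 ^ S.sup id)) :
    TripleJoined (suppress (subdividedMobius k) W) (Set.Iio (5 * k) \ W) := by
  intro S hSW hS
  have hmem : S ∈ (Finset.range (5 * k) \ W).powersetCard 3 :=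
    Finset.mem_powersetCard.2 ⟨by simpa [← Finset.coe_subset] using hSW, hS⟩
  obtain ⟨M, -, hM⟩ := h S hmem
  exact doublyJoined_of_spreadsTo (suppress_adj_of_mem_ladderEdges hW) hM

lemma tripleJoined_subdividedMobius (hk : 3 ≤ k) :
    TripleJoined (subdividedMobius k) (Set.Iio (5 * k)) := by
  induction k, hk using Nat.le_induction with
  | base =>
    have h := tripleJoined_of_spreadsTo (k := 3) (W := ∅) (Finset.empty_subset _)
      [24751, 13526, 10208, 16599, 9518, 1005, 29711, 26025, 8446, 9720, 17673, 58, 16633, 13654,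
        93, 29791, 599, 24623, 16449, 14329, 16447, 1024] (by decide +kernel)
    rwa [Finset.coe_empty, suppress_empty, Set.sdiff_empty] at h
  | succ k hk ih => exact tripleJoined_subdividedMobius_succ hk ih

end TripleJoined

section Order

variable {V : Type*} {G : SimpleGraph V}

lemma genConnectivity_le_of_two_mul_card_edgeFinset_lt [Fintype V] [DecidableRel G.Adj] {k d : ℕ}
    (hk : 2 ≤ k) (hkV : k ≤ Fintype.card V)
    (h : 2 * G.edgeFinset.card < (d + 1) * Fintype.card V) : genConnectivity k G ≤ d := by
  obtain ⟨v, -, hv⟩ : ∃ v ∈ Finset.univ, G.degree v < d + 1 := by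
    refine Finset.exists_lt_of_sum_lt ?_
    rw [Finset.sum_const, smul_eq_mul, Finset.card_univ, mul_comm,
      sum_degrees_eq_twice_card_edges]
    exact h
  exact (genConnectivity_le_degree hk hkV v).trans (by exact_mod_cast Nat.le_of_lt_succ hv)

lemma ncard_edgeSet_comap_le {U : Type*} {g : U → V} (hg : g.Injective) (hG : G.edgeSet.Finite) :
    (G.comap g).edgeSet.ncard ≤ G.edgeSet.ncard :=
  Set.ncard_le_ncard_of_injOn (Sym2.map g) (by rintro ⟨x, y⟩ h; exact h)
    (Sym2.map.injective hg).injOn hG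

lemma DoublyJoined.comap {U : Type*} [Nonempty U] {g : U → V} {S : Set U} (hg : g.Injective)
    (hG : G.support ⊆ Set.range g) (h : DoublyJoined G (g '' S)) :
    DoublyJoined (G.comap g) S := by
  have hinv {x : V} (hx : x ∈ G.support) : g (g.invFun x) = x := Function.invFun_eq (hG hx)
  have himage := h.image_of_injOn (f := g.invFun) (H := G.comap g)
    (fun x hx y hy hxy => by rw [← hinv hx, hxy, hinv hy])
    (fun x y hxy => by rwa [comap_adj, hinv ⟨y, hxy⟩, hinv ⟨x, hxy.symm⟩])
  rwa [← Set.image_comp, Function.invFun_comp hg, Set.image_id] at himage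

lemma exists_connected_of_tripleJoined {A : Finset V} (hA : 3 ≤ A.card)
    (h : TripleJoined G A) (hGA : G.support ⊆ A) (hG : G.edgeSet.Finite)
    (hcard : 2 * G.edgeSet.ncard < 3 * A.card) :
    ∃ G' : SimpleGraph (Fin A.card), G'.Connected ∧ genConnectivity 3 G' = 2 ∧
      G'.edgeSet.ncard ≤ G.edgeSet.ncard := by
  classical
  let g : Fin A.card → V := fun i => A.equivFin.symm i
  have hg : g.Injective := Subtype.val_injective.comp A.equivFin.symm.injective
  have hrange : Set.range g = A :=
    (A.equivFin.symm.surjective.range_comp Subtype.val).trans Subtype.range_coe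
  have : Nonempty (Fin A.card) := ⟨⟨0, by omega⟩⟩
  have hcardA : 3 ≤ Fintype.card (Fin A.card) := by simpa
  have hedges := ncard_edgeSet_comap_le hg hG
  have hlower : 2 ≤ genConnectivity 3 (G.comap g) := by
    refine (two_le_genConnectivity_iff (by norm_num)).2 fun S hS => ?_
    refine DoublyJoined.comap hg (hGA.trans_eq hrange.symm) ?_
    rw [← Finset.coe_image]
    refine h _ ?_ (by rw [Finset.card_image_of_injective _ hg, hS])
    rw [Finset.coe_image, ← hrange]
    exact Set.image_subset_range ..
  have hupper : genConnectivity 3 (G.comap g) ≤ 2 := by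
    refine genConnectivity_le_of_two_mul_card_edgeFinset_lt (d := 2) (by norm_num) hcardA ?_
    rw [← coe_edgeFinset, Set.ncard_coe_finset] at hedges
    rw [Fintype.card_fin]
    omega
  exact ⟨_, connected_of_two_le_genConnectivity (by norm_num) hcardA hlower,
    hupper.antisymm hlower, hedges⟩

end Order

section Extremal

variable {k n : ℕ} {W : Finset ℕ}

lemma support_suppress_subdividedMobius_subset :
    (suppress (subdividedMobius k) W).support ⊆ (Finset.range (5 * k) \ W : Finset ℕ) := by
  rintro x ⟨y, hxy⟩
  obtain ⟨z, hz⟩ := exists_adj_of_suppress_adj hxy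
  simpa using ⟨(lt_and_lt_of_subdividedMobius_adj hz).1, hxy.2.1⟩

lemma edgeSet_suppress_subdividedMobius_subset (hW : W ⊆ links k) :
    (suppress (subdividedMobius k) W).edgeSet ⊆
      (W.image (fun w => s(firstEnd w, secondEnd k w)) ∪
        ((links k \ W).image (fun x => s(x, firstEnd x)) ∪
          (links k \ W).image fun x => s(x, secondEnd k x)) : Finset (Sym2 ℕ)) := by
  rintro ⟨x, y⟩ ⟨hne, hx, hy, hxy | ⟨w, hw, hwx, hwy⟩⟩
  · have hlink := subdividedMobius_adj.1 hxy
    simp only [Finset.coe_union, Finset.coe_image, Set.mem_union, Set.mem_image, Finset.mem_coe,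
      Finset.mem_sdiff]
    grind
  · rw [subdividedMobius_adj_of_mem_links (hW hw)] at hwx hwy
    refine Finset.mem_union_left _ (Finset.mem_image.2 ⟨w, hw, ?_⟩)
    grind

lemma finite_edgeSet_suppress_subdividedMobius (hW : W ⊆ links k) :
    (suppress (subdividedMobius k) W).edgeSet.Finite :=
  (Finset.finite_toSet _).subset (edgeSet_suppress_subdividedMobius_subset hW)

lemma ncard_edgeSet_suppress_subdividedMobius_add_card_le (hW : W ⊆ links k) :
    (suppress (subdividedMobius k) W).edgeSet.ncard + W.card ≤ 6 * k := by
  have hcard := Set.ncard_le_ncard (edgeSet_suppress_subdividedMobius_subset hW)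
  rw [Set.ncard_coe_finset] at hcard
  have hunion := hcard.trans (Finset.card_union_le _ _ |>.trans <|
    add_le_add Finset.card_image_le <| Finset.card_union_le _ _ |>.trans <|
    add_le_add Finset.card_image_le Finset.card_image_le)
  have hlinks := Finset.card_sdiff_add_card_eq_card hW
  rw [card_links] at hlinks
  omega

lemma exists_connected_of_tripleJoined_suppress (hW : W ⊆ links k)
    (hn : n + W.card = 5 * k) (hkn : 2 * k < n)
    (h : TripleJoined (suppress (subdividedMobius k) W) (Set.Iio (5 * k) \ W)) :
    ∃ G : SimpleGraph (Fin n), G.Connected ∧ genConnectivity 3 G = 2 ∧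
      G.edgeSet.ncard ≤ n + k := by
  have hrange : links k ⊆ Finset.range (5 * k) := Finset.filter_subset _ _
  have hedges := ncard_edgeSet_suppress_subdividedMobius_add_card_le hW
  obtain rfl : (Finset.range (5 * k) \ W).card = n := by
    rw [Finset.card_sdiff_of_subset (hW.trans hrange), Finset.card_range]
    omega
  obtain ⟨G, hconn, hG, hcard⟩ := exists_connected_of_tripleJoined (by omega) (by simpa using h)
    support_suppress_subdividedMobius_subset (finite_edgeSet_suppress_subdividedMobius hW)
    (by omega)
  exact ⟨G, hconn, hG, hcard.trans (by omega)⟩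

lemma exists_connected_of_three_le (hk : 3 ≤ k) (hkn : 2 * k < n) (hnk : n ≤ 5 * k) :
    ∃ G : SimpleGraph (Fin n), G.Connected ∧ genConnectivity 3 G = 2 ∧
      G.edgeSet.ncard ≤ n + k := by
  obtain ⟨W, hW, hcard⟩ := Finset.exists_subset_card_eq (s := links k) (n := 5 * k - n)
    (by rw [card_links]; omega)
  exact exists_connected_of_tripleJoined_suppress hW (by omega) hkn
    (tripleJoined_suppress (by omega) hW (tripleJoined_subdividedMobius hk))

lemma exists_connected_ncard_edgeSet_le (h4 : 4 ≤ n) (h9 : n ≠ 9) (h10 : n ≠ 10) :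
    ∃ G : SimpleGraph (Fin n), G.Connected ∧ genConnectivity 3 G = 2 ∧
      G.edgeSet.ncard ≤ n + (n + 4) / 5 := by
  obtain hn | hn := le_or_gt 11 n
  · exact exists_connected_of_three_le (by omega) (by omega) (by omega)
  interval_cases n
  · exact exists_connected_of_tripleJoined_suppress (k := 1) (W := {2}) (by decide) rfl (by decide)
      (tripleJoined_of_spreadsTo (by decide) [1] (by decide +kernel))
  · exact exists_connected_of_tripleJoined_suppress (k := 1) (W := ∅) (by decide) rfl (by decide)
      (tripleJoined_of_spreadsTo (by decide) [5, 6, 9] (by decide +kernel))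
  · exact exists_connected_of_tripleJoined_suppress (k := 2) (W := {2, 3, 4, 7}) (by decide) rfl
      (by decide) (tripleJoined_of_spreadsTo (by decide) [3, 33] (by decide +kernel))
  · exact exists_connected_of_tripleJoined_suppress (k := 2) (W := {2, 4, 7}) (by decide) rfl
      (by decide) (tripleJoined_of_spreadsTo (by decide) [11, 259, 1, 2, 40] (by decide +kernel))
  · exact exists_connected_of_tripleJoined_suppress (k := 2) (W := {2, 7}) (by decide) rfl
      (by decide) (tripleJoined_of_spreadsTo (by decide) [27, 120, 41, 266, 312, 1, 43]
        (by decide +kernel))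
  · contradiction
  · contradiction

end Extremal

section Bounds

variable {V : Type*} [Fintype V] {G : SimpleGraph V}

lemma ceil_six_fifths_mul (n : ℕ) : ⌈(6 / 5 : ℚ) * n⌉₊ = n + (n + 4) / 5 := by
  refine eq_of_forall_ge_iff fun m => ?_
  rw [Nat.ceil_le, div_mul_eq_mul_div, div_le_iff₀ (by norm_num)]
  norm_cast
  omega

lemma card_add_le_ncard_edgeSet (h : genConnectivity 3 G = 2) :
    Fintype.card V + (Fintype.card V + 4) / 5 ≤ G.edgeSet.ncard := by
  classical
  have hV := le_card_of_genConnectivity_ne_top (h.trans_ne (ENat.ofNat_ne_top 2))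
  have := six_mul_card_le_five_mul_card_edgeFinset le_rfl hV h.ge
  rw [← coe_edgeFinset, Set.ncard_coe_finset]
  omega

lemma card_add_three_le_ncard_edgeSet (h : genConnectivity 3 G = 2)
    (hV : Fintype.card V = 9 ∨ Fintype.card V = 10) :
    Fintype.card V + 3 ≤ G.edgeSet.ncard := by
  classical
  rw [← coe_edgeFinset, Set.ncard_coe_finset]
  exact card_add_three_le_card_edgeFinset h.ge hV

end Bounds

end GenConn

theorem theorem1 :
    -- the lower bound
    (∀ (V : Type*) [Fintype V] (G : SimpleGraph V), GenConn.genConnectivity 3 G = 2 →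
      ⌈(6 / 5 : ℚ) * (Fintype.card V : ℚ)⌉₊ ≤ G.edgeSet.ncard) ∧
    -- it is attained for every order `n ≥ 4` other than `9` and `10`
    (∀ n : ℕ, 4 ≤ n → n ≠ 9 → n ≠ 10 →
      ∃ G : SimpleGraph (Fin n), G.Connected ∧ GenConn.genConnectivity 3 G = 2 ∧
        G.edgeSet.ncard = ⌈(6 / 5 : ℚ) * (n : ℚ)⌉₊) ∧
    -- for the orders `9` and `10` the minimum is larger by one
    (∀ (V : Type*) [Fintype V] (G : SimpleGraph V),
      (Fintype.card V = 9 ∨ Fintype.card V = 10) → GenConn.genConnectivity 3 G = 2 →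
      ⌈(6 / 5 : ℚ) * (Fintype.card V : ℚ)⌉₊ + 1 ≤ G.edgeSet.ncard) ∧
    (∀ n : ℕ, (n = 9 ∨ n = 10) →
      ∃ G : SimpleGraph (Fin n), G.Connected ∧ GenConn.genConnectivity 3 G = 2 ∧
        G.edgeSet.ncard = ⌈(6 / 5 : ℚ) * (n : ℚ)⌉₊ + 1) := by
  simp only [GenConn.ceil_six_fifths_mul]
  refine ⟨fun V _ G h => GenConn.card_add_le_ncard_edgeSet h, fun n hn h9 h10 => ?_,
    fun V _ G hV h => ?_, fun n hn => ?_⟩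
  · obtain ⟨G, hconn, hG, hcard⟩ := GenConn.exists_connected_ncard_edgeSet_le hn h9 h10
    have hlower := GenConn.card_add_le_ncard_edgeSet hG
    rw [Fintype.card_fin] at hlower
    exact ⟨G, hconn, hG, hcard.antisymm hlower⟩
  · have := GenConn.card_add_three_le_ncard_edgeSet h hV
    omega
  · obtain ⟨G, hconn, hG, hcard⟩ :=
      GenConn.exists_connected_of_three_le (k := 3) le_rfl (by omega : 6 < n) (by omega)
    have hlower := GenConn.card_add_three_le_ncard_edgeSet hG (by simpa using hn)
    rw [Fintype.card_fin] at hlower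
    exact ⟨G, hconn, hG, by omega⟩
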